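/- Let $\mathcal X$ be a complete separable metric space and $\mathcal Y\subset\mathbb R$ a closed set; write $\mathcal X^2=\mathcal X\times\mathcal X$, and let $\mathcal M_1(\mathcal X\times\mathcal Y)$ be the set of Borel probability measures on $\mathcal X\times\mathcal Y$ with the topology of weak convergence. Let $H$ be a separable real reproducing kernel Hilbert space of functions on $\mathcal X^2$ whose reproducing kernel $k:\mathcal X^2\times\mathcal X^2\to\mathbb R$ is continuous and bounded (that is, $\sup_{v\in\mathcal X^2}\sqrt{k(v,v)}<\infty$). Let $L:(\mathcal X\times\mathcal Y)^2\times\mathbb R\to[0,\infty)$ be measurable, and suppose that $t\mapsto L(z,t)$ is convex, is Lipschitz continuous with a constant independent of $z$, and is twice differentiable for every $z=(x,y,x',y')\in(\mathcal X\times\mathcal Y)^2$, and that the first and second partial derivatives of $L$ with respect to $t$ are continuous and bounded functions on $(\mathcal X\times\mathcal Y)^2\times\mathbb R$. Put $L^*(z,t)=L(z,t)-L(z,0)$. Then for every $\lambda>0$ and every $P\in\mathcal M_1(\mathcal X\times\mathcal Y)$ the functional $$f\mapsto \int_{(\mathcal X\times\mathcal Y)^2} L^*\bigl(x,y,x',y',f(x,x')\bigr)\,dP^2(x,y,x',y')+\lambda\|f\|_H^2,\qquad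 P^2=P\otimes P,$$ is well defined and finite on $H$ (the integrand is $P^2$-integrable) and has exactly one minimizer $f_{L^*,P,\lambda}\in H$. For every $\lambda>0$ the following hold. 1. The map $S:\mathcal M_1(\mathcal X\times\mathcal Y)\to H$, $S(P)=f_{L^*,P,\lambda}$, is continuous with respect to the weak topology on $\mathcal M_1(\mathcal X\times\mathcal Y)$ and the norm topology on $H$. 2. Each $f_{L^*,P,\lambda}$ is a bounded continuous function on $\mathcal X^2$, and the map $P\mapsto f_{L^*,P,\lambda}$ from $\mathcal M_1(\mathcal X\times\mathcal Y)$ to $C_b(\mathcal X^2)$ is continuous with respect to the weak topology and the supremum norm. -/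

import Mathlib

open MeasureTheory

namespace PairwiseLearning

/-- A pairwise loss function on `(X × Y)² × ℝ`: a nonnegative measurable function.
The argument `z = ((x, y), (x', y'))` collects the two data points. -/
structure IsPairwiseLoss {X : Type*} [MeasurableSpace X] {Y : Set ℝ}
    (L : (X × Y) × (X × Y) → ℝ → ℝ) : Prop where
  measurable : Measurable (Function.uncurry L)
  nonneg : ∀ z t, 0 ≤ L z t

/-- The partial derivative of a loss function with respect to its last (real) argument. -/
noncomputable def D5 {Z : Type*} (L : Z → ℝ → ℝ) : Z → ℝ → ℝ :=
  fun z t => deriv (L z) t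

/-- The shifted loss function `L*(z, t) = L(z, t) - L(z, 0)`. -/
def shifted {Z : Type*} (L : Z → ℝ → ℝ) : Z → ℝ → ℝ :=
  fun z t => L z t - L z 0

/-- The function `(x, y, x', y') ↦ ℓ(x, y, x', y', f(x, x'))`. -/
def lossAt {X : Type*} {Y : Set ℝ} (l : (X × Y) × (X × Y) → ℝ → ℝ) (f : X × X → ℝ) :
    (X × Y) × (X × Y) → ℝ :=
  fun z => l z (f (z.1.1, z.2.1))

/-- The risk of `f`: the integral of `ℓ(x, y, x', y', f(x, x'))` with respect to `P ⊗ P`. -/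
noncomputable def risk {X : Type*} [MeasurableSpace X] {Y : Set ℝ}
    (l : (X × Y) × (X × Y) → ℝ → ℝ) (P : ProbabilityMeasure (X × Y)) (f : X × X → ℝ) : ℝ :=
  ∫ z, lossAt l f z ∂((P : Measure (X × Y)).prod (P : Measure (X × Y)))

/-- The regularized risk `f ↦ R_{ℓ,P}(f) + lam ‖f‖_H²` on a Hilbert space `H` of functions. -/
noncomputable def regRisk {X : Type*} [MeasurableSpace X] {Y : Set ℝ} {H : Type*}
    [NormedAddCommGroup H] [InnerProductSpace ℝ H] [RKHS ℝ H (X × X) ℝ]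
    (l : (X × Y) × (X × Y) → ℝ → ℝ) (lam : ℝ) (P : ProbabilityMeasure (X × Y)) (f : H) : ℝ :=
  risk l P f + lam * ‖f‖ ^ 2

/-- `f ∈ H` minimizes the regularized risk over `H`. -/
def IsRegRiskMinimizer {X : Type*} [MeasurableSpace X] {Y : Set ℝ} {H : Type*}
    [NormedAddCommGroup H] [InnerProductSpace ℝ H] [RKHS ℝ H (X × X) ℝ]
    (l : (X × Y) × (X × Y) → ℝ → ℝ) (lam : ℝ) (P : ProbabilityMeasure (X × Y)) (f : H) : Prop :=
  ∀ g : H, regRisk l lam P f ≤ regRisk l lam P g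

/-- The regularized pairwise learning operator `P ↦ f_{L*,P,lam}`: it selects a minimizer in `H`
of the regularized risk of the shifted loss (meaningful where a unique minimizer exists). -/
noncomputable def rplOperator {X : Type*} [MeasurableSpace X] {Y : Set ℝ} (H : Type*)
    [NormedAddCommGroup H] [InnerProductSpace ℝ H] [RKHS ℝ H (X × X) ℝ]
    (L : (X × Y) × (X × Y) → ℝ → ℝ) (lam : ℝ) (P : ProbabilityMeasure (X × Y)) : H :=
  Classical.epsilon (IsRegRiskMinimizer (shifted L) lam P)

end PairwiseLearning

namespace PairwiseLearning

open Filter Topology RealInnerProductSpace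

/-! By the reproducing property `f (x, x') = ⟪φ z, f⟫` with `φ` bounded and continuous, so the risk
is an integral of `l z ⟪φ z, f⟫` against a single measure `μ = P ⊗ P`. Lipschitz continuity makes it
finite; convexity plus the parallelogram identity give a unique minimizer
(`existsUnique_minimizer_add_sq`).

For continuity, let `f`, `g` be the minimizers for `μ`, `ν`. The optimality condition at `f` and the
subgradient inequality for `ν` give `‖g - f‖ ≤ lam⁻¹ * ‖∫ G dν - ∫ G dμ‖`, where `G z = ∂ₜ l(z, ⟪φ
z, f⟫) • φ z` (`norm_minimizer_sub_le`). Here `G` is bounded, continuous and independent of `ν`, so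
the right side tends to `0` as `ν → μ` weakly (`continuous_integral_boundedContinuous`). Finally `P
↦ P ⊗ P` is weakly continuous, and the norm of `H` dominates the supremum norm up to a constant. -/

theorem integrable_boundedContinuous {Ω E : Type*} [TopologicalSpace Ω]
    [SecondCountableTopology Ω] [MeasurableSpace Ω] [OpensMeasurableSpace Ω]
    [NormedAddCommGroup E] (G : BoundedContinuousFunction Ω E)
    (μ : Measure Ω) [IsFiniteMeasure μ] : Integrable G μ :=
  Integrable.of_bound G.continuous.aestronglyMeasurable ‖G‖ (ae_of_all _ G.norm_coe_le_norm)

/-! ### Weak continuity of Hilbert-space-valued integrals. -/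

section WeakConvergence

variable {Ω E : Type*} [TopologicalSpace Ω] [SecondCountableTopology Ω]
  [MeasurableSpace Ω] [OpensMeasurableSpace Ω]
  [NormedAddCommGroup E] [InnerProductSpace ℝ E]

/-- The bounded continuous function `(x, y) ↦ ⟪G x, G y⟫`. -/
noncomputable def innerBCF (G : BoundedContinuousFunction Ω E) :
    BoundedContinuousFunction (Ω × Ω) ℝ :=
  BoundedContinuousFunction.ofNormedAddCommGroup (fun p => ⟪G p.1, G p.2⟫)
    ((G.continuous.comp continuous_fst).inner (G.continuous.comp continuous_snd)) (‖G‖ * ‖G‖)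
    fun _ => (norm_inner_le_norm _ _).trans
      (mul_le_mul (G.norm_coe_le_norm _) (G.norm_coe_le_norm _) (norm_nonneg _) (norm_nonneg _))

variable [CompleteSpace E]

/-- Fubini reduces vector-valued integrals to a scalar bounded continuous integrand on the product,
where weak convergence applies directly. -/
theorem inner_integral_integral (G : BoundedContinuousFunction Ω E)
    (μ ν : ProbabilityMeasure Ω) :
    ⟪∫ x, G x ∂(μ : Measure Ω), ∫ x, G x ∂(ν : Measure Ω)⟫
      = ∫ p, innerBCF G p ∂(μ.prod ν : Measure (Ω × Ω)) := by
  rw [ProbabilityMeasure.toMeasure_prod, integral_prod _ (integrable_boundedContinuous _ _)]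
  have hν := integrable_boundedContinuous G (ν : Measure Ω)
  have hμ := integrable_boundedContinuous G (μ : Measure Ω)
  rw [real_inner_comm, ← integral_inner hμ]
  refine integral_congr_ae (ae_of_all _ fun x => ?_)
  change _ = ∫ y, ⟪G x, G y⟫ ∂(ν : Measure Ω)
  rw [integral_inner hν, real_inner_comm]

/-- Bochner integration of a bounded continuous function with values in a Hilbert space is
continuous in the weak topology on probability measures. -/
theorem continuous_integral_boundedContinuous [TopologicalSpace.PseudoMetrizableSpace Ω]
    (G : BoundedContinuousFunction Ω E) :
    Continuous fun μ : ProbabilityMeasure Ω => ∫ x, G x ∂(μ : Measure Ω) := by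
  have hI : Continuous fun p : ProbabilityMeasure Ω × ProbabilityMeasure Ω =>
      ⟪∫ x, G x ∂(p.1 : Measure Ω), ∫ x, G x ∂(p.2 : Measure Ω)⟫ := by
    simp_rw [inner_integral_integral]
    exact (ProbabilityMeasure.continuous_integral_boundedContinuousFunction (innerBCF G)).comp
      ProbabilityMeasure.continuous_prod
  rw [continuous_iff_continuousAt]
  intro μ
  rw [ContinuousAt, tendsto_iff_norm_sub_tendsto_zero]
  -- Expanding the square leaves only inner products of integrals: `h1` is `hI` on the diagonal,
  -- `h2` is `hI` with the second measure frozen at `μ`.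
  have hsq : Continuous fun ν : ProbabilityMeasure Ω =>
      √(‖(∫ x, G x ∂(ν : Measure Ω)) - ∫ x, G x ∂(μ : Measure Ω)‖ ^ 2) := by
    simp_rw [norm_sub_sq_real, ← real_inner_self_eq_norm_sq]
    have h1 := hI.comp (continuous_id.prodMk continuous_id)
    have h2 := hI.comp (continuous_id.prodMk (continuous_const (y := μ)))
    exact ((h1.sub (h2.const_mul 2)).add continuous_const).sqrt
  simpa [Real.sqrt_sq (norm_nonneg _)] using hsq.tendsto μ

end WeakConvergence

/-! ### Minimizers of a convex functional plus a squared norm. -/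

section StronglyConvex

variable {E : Type*} [NormedAddCommGroup E] [InnerProductSpace ℝ E]

/-- The parallelogram identity makes the midpoint gap of the quadratic term exactly `lam / 4 * ‖f -
g‖ ^ 2`; this gap drives both existence and uniqueness. -/
theorem midpoint_add_sq_le {R : E → ℝ} (hR : ConvexOn ℝ Set.univ R) (lam : ℝ) (f g : E) :
    R ((1 / 2 : ℝ) • f + (1 / 2 : ℝ) • g) + lam * ‖(1 / 2 : ℝ) • f + (1 / 2 : ℝ) • g‖ ^ 2
        + lam / 4 * ‖f - g‖ ^ 2
      ≤ ((R f + lam * ‖f‖ ^ 2) + (R g + lam * ‖g‖ ^ 2)) / 2 := by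
  have h := hR.2 (Set.mem_univ f) (Set.mem_univ g) (by norm_num : (0 : ℝ) ≤ 1 / 2)
    (by norm_num : (0 : ℝ) ≤ 1 / 2) (by norm_num)
  have hp : ‖(1 / 2 : ℝ) • f + (1 / 2 : ℝ) • g‖ ^ 2
      = (‖f‖ ^ 2 + 2 * ⟪f, g⟫ + ‖g‖ ^ 2) / 4 := by
    rw [← smul_add, norm_smul, mul_pow, norm_add_sq_real]
    norm_num
    ring
  rw [hp, norm_sub_sq_real]
  simp only [smul_eq_mul] at h
  linarith

/-- A convex continuous functional of at most linear decay, regularized by a multiple of the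
squared norm, has exactly one minimizer on a Hilbert space. -/
theorem existsUnique_minimizer_add_sq [CompleteSpace E] {R : E → ℝ}
    (hR : ConvexOn ℝ Set.univ R) (hc : Continuous R) {C : ℝ} (hC : ∀ f, -(C * ‖f‖) ≤ R f)
    {lam : ℝ} (hlam : 0 < lam) :
    ∃! f : E, ∀ g, R f + lam * ‖f‖ ^ 2 ≤ R g + lam * ‖g‖ ^ 2 := by
  set J : E → ℝ := fun f => R f + lam * ‖f‖ ^ 2 with hJ
  have hJc : Continuous J := by fun_prop
  have hbdd : BddBelow (Set.range J) := by
    -- The minimum of `lam * r ^ 2 - C * r` over real `r`, by completing the square.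
    refine ⟨-(C ^ 2 / (4 * lam)), ?_⟩
    rintro _ ⟨f, rfl⟩
    have h1 : 0 ≤ (2 * lam * ‖f‖ - C) ^ 2 / (4 * lam) := by positivity
    have h2 : (2 * lam * ‖f‖ - C) ^ 2 / (4 * lam)
        = lam * ‖f‖ ^ 2 - C * ‖f‖ + C ^ 2 / (4 * lam) := by
      field_simp
      ring
    have := hC f
    simp only [hJ]
    linarith
  set m := sInf (Set.range J)
  have hm : ∀ f, m ≤ J f := fun f => csInf_le hbdd ⟨f, rfl⟩
  -- The midpoint has value at least `m`, so near-minimizers are close: minimizing sequences are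
  -- Cauchy and two minimizers coincide.
  have key : ∀ f g, lam / 4 * ‖f - g‖ ^ 2 ≤ (J f + J g) / 2 - m := fun f g => by
    have h1 := midpoint_add_sq_le hR lam f g
    have h2 := hm ((1 / 2 : ℝ) • f + (1 / 2 : ℝ) • g)
    simp only [hJ] at h2 ⊢
    linarith
  have hex : ∀ n : ℕ, ∃ f, J f < m + 1 / ((n : ℝ) + 1) := fun n => by
    obtain ⟨_, ⟨f, rfl⟩, hf⟩ := exists_lt_of_csInf_lt (Set.range_nonempty J)
      (lt_add_of_pos_right m (Nat.one_div_pos_of_nat (α := ℝ) (n := n)))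
    exact ⟨f, hf⟩
  choose u hu using hex
  have hcau : CauchySeq u := by
    refine cauchySeq_of_le_tendsto_0 (fun n : ℕ => √(4 / lam * (1 / ((n : ℝ) + 1)))) ?_ ?_
    · intro n k N hn hk
      rw [dist_eq_norm]
      refine Real.le_sqrt_of_sq_le ?_
      have h1 := key (u n) (u k)
      have h2 := (hu n).trans_le
        (add_le_add_right (Nat.one_div_le_one_div (α := ℝ) hn) m)
      have h3 := (hu k).trans_le
        (add_le_add_right (Nat.one_div_le_one_div (α := ℝ) hk) m)
      have h4 : lam / 4 * ‖u n - u k‖ ^ 2 ≤ 1 / ((N : ℝ) + 1) := by linarith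
      calc ‖u n - u k‖ ^ 2 = 4 / lam * (lam / 4 * ‖u n - u k‖ ^ 2) := by field_simp
        _ ≤ _ := by gcongr
    · have := ((tendsto_one_div_add_atTop_nhds_zero_nat (𝕜 := ℝ)).const_mul (4 / lam)).sqrt
      simpa using this
  obtain ⟨f, hf⟩ := cauchySeq_tendsto_of_complete hcau
  have hfm : J f ≤ m := by
    refine le_of_tendsto_of_tendsto' ((hJc.tendsto f).comp hf) ?_ fun n => (hu n).le
    simpa using (tendsto_one_div_add_atTop_nhds_zero_nat (𝕜 := ℝ)).const_add m
  refine ⟨f, fun g => hfm.trans (hm g), fun g hg => ?_⟩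
  have h1 := key g f
  have h2 : J g ≤ J f := hg f
  have h3 : lam / 4 * ‖g - f‖ ^ 2 ≤ 0 := by linarith
  have h4 : ‖g - f‖ ^ 2 ≤ 0 := nonpos_of_mul_nonpos_right h3 (by positivity)
  exact sub_eq_zero.1 (norm_eq_zero.1 (pow_eq_zero_iff two_ne_zero |>.1
    (le_antisymm h4 (sq_nonneg _))))

end StronglyConvex

/-! ### Risks on a feature space: optimality and stability. -/

section Feature

variable {Ω E : Type*} [TopologicalSpace Ω] [NormedAddCommGroup E] [InnerProductSpace ℝ E]
  {l : Ω → ℝ → ℝ} {K : NNReal} (φ : BoundedContinuousFunction Ω E)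

theorem abs_inner_feature_le (z : Ω) (f : E) :
    |⟪φ z, f⟫| ≤ ‖φ‖ * ‖f‖ :=
  (abs_real_inner_le_norm _ _).trans (by gcongr; exact φ.norm_coe_le_norm z)

theorem continuous_inner_feature (f : E) :
    Continuous fun z => ⟪φ z, f⟫ :=
  φ.continuous.inner continuous_const

theorem abs_featureLoss_sub_le (hLip : ∀ z, LipschitzWith K (l z)) (z : Ω) (f g : E) :
    |l z ⟪φ z, f⟫ - l z ⟪φ z, g⟫| ≤ K * ‖φ‖ * ‖f - g‖ := by
  have h1 := (hLip z).dist_le_mul ⟪φ z, f⟫ ⟪φ z, g⟫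
  rw [Real.dist_eq, Real.dist_eq, ← inner_sub_right] at h1
  calc _ ≤ _ := h1
    _ ≤ K * (‖φ‖ * ‖f - g‖) := by gcongr; exact abs_inner_feature_le φ z _
    _ = _ := by ring

theorem abs_featureLoss_le (hLip : ∀ z, LipschitzWith K (l z)) (h0 : ∀ z, l z 0 = 0)
    (z : Ω) (f : E) : |l z ⟪φ z, f⟫| ≤ K * ‖φ‖ * ‖f‖ := by
  simpa [h0] using abs_featureLoss_sub_le φ hLip z f 0

end Feature

section FeatureRisk

variable {Ω E : Type*} [TopologicalSpace Ω] [MeasurableSpace Ω] [OpensMeasurableSpace Ω]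
  [NormedAddCommGroup E] [InnerProductSpace ℝ E]

/-- The risk of the linear functional `z ↦ ⟪φ z, f⟫` on a feature space. -/
noncomputable def featureRisk (l : Ω → ℝ → ℝ) (φ : Ω → E) (μ : Measure Ω) (f : E) : ℝ :=
  ∫ z, l z ⟪φ z, f⟫ ∂μ

variable {l : Ω → ℝ → ℝ} {K : NNReal} (φ : BoundedContinuousFunction Ω E)

theorem aestronglyMeasurable_featureLoss (hl : Measurable (Function.uncurry l))
    (μ : Measure Ω) (f : E) : AEStronglyMeasurable (fun z => l z ⟪φ z, f⟫) μ :=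
  (hl.comp (measurable_id.prodMk
    (continuous_inner_feature φ f).measurable)).aestronglyMeasurable

theorem integrable_featureLoss (hl : Measurable (Function.uncurry l))
    (hLip : ∀ z, LipschitzWith K (l z)) (h0 : ∀ z, l z 0 = 0)
    (μ : Measure Ω) [IsFiniteMeasure μ] (f : E) : Integrable (fun z => l z ⟪φ z, f⟫) μ :=
  Integrable.of_bound (aestronglyMeasurable_featureLoss φ hl μ f) (K * ‖φ‖ * ‖f‖)
    (ae_of_all _ fun z => abs_featureLoss_le φ hLip h0 z f)

theorem convexOn_featureRisk (hl : Measurable (Function.uncurry l))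
    (hLip : ∀ z, LipschitzWith K (l z)) (h0 : ∀ z, l z 0 = 0)
    (hconv : ∀ z, ConvexOn ℝ Set.univ (l z)) (μ : Measure Ω) [IsFiniteMeasure μ] :
    ConvexOn ℝ Set.univ (featureRisk l φ μ) := by
  have hi := integrable_featureLoss φ hl hLip h0 μ
  refine ⟨convex_univ, fun f _ g _ a b ha hb hab => ?_⟩
  simp only [featureRisk, smul_eq_mul]
  rw [← integral_const_mul, ← integral_const_mul,
    ← integral_add ((hi f).const_mul a) ((hi g).const_mul b)]
  refine integral_mono (hi _) (((hi f).const_mul a).add ((hi g).const_mul b)) fun z => ?_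
  have := (hconv z).2 (Set.mem_univ ⟪φ z, f⟫) (Set.mem_univ ⟪φ z, g⟫) ha hb hab
  simpa [inner_add_right, inner_smul_right] using this

theorem abs_featureRisk_sub_le (hl : Measurable (Function.uncurry l))
    (hLip : ∀ z, LipschitzWith K (l z)) (h0 : ∀ z, l z 0 = 0)
    (μ : Measure Ω) [IsProbabilityMeasure μ] (f g : E) :
    |featureRisk l φ μ f - featureRisk l φ μ g| ≤ K * ‖φ‖ * ‖f - g‖ := by
  have hi := integrable_featureLoss φ hl hLip h0 μ
  rw [featureRisk, featureRisk, ← integral_sub (hi f) (hi g)]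
  have h : ∀ᵐ z ∂μ, ‖l z ⟪φ z, f⟫ - l z ⟪φ z, g⟫‖ ≤ K * ‖φ‖ * ‖f - g‖ :=
    ae_of_all _ fun z => abs_featureLoss_sub_le φ hLip z f g
  simpa using norm_integral_le_of_norm_le_const h

theorem existsUnique_featureRisk_minimizer [CompleteSpace E]
    (hl : Measurable (Function.uncurry l))
    (hLip : ∀ z, LipschitzWith K (l z)) (h0 : ∀ z, l z 0 = 0)
    (hconv : ∀ z, ConvexOn ℝ Set.univ (l z)) (μ : Measure Ω) [IsProbabilityMeasure μ]
    {lam : ℝ} (hlam : 0 < lam) :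
    ∃! f : E, ∀ g, featureRisk l φ μ f + lam * ‖f‖ ^ 2
      ≤ featureRisk l φ μ g + lam * ‖g‖ ^ 2 := by
  have hsub := abs_featureRisk_sub_le φ hl hLip h0 μ
  refine existsUnique_minimizer_add_sq (convexOn_featureRisk φ hl hLip h0 hconv μ) ?_
    (C := K * ‖φ‖) (fun f => ?_) hlam
  · refine (LipschitzWith.of_dist_le_mul (K := K * ‖φ‖₊) fun f g => ?_).continuous
    simpa [Real.dist_eq, dist_eq_norm] using hsub f g
  -- The risk vanishes at `0`, so its Lipschitz bound also controls its decay.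
  · have h := hsub f 0
    have h00 : featureRisk l φ μ 0 = 0 := by simp [featureRisk, h0]
    rw [h00, sub_zero, sub_zero] at h
    exact (abs_le.1 h).1

/-- The bounded continuous function `z ↦ ∂ₜ l(z, ⟪φ z, f⟫) • φ z`, the gradient at `f` of the
integrand of the risk. -/
noncomputable def gradBCF (hD : Continuous (Function.uncurry (D5 l)))
    {c : ℝ} (hc : ∀ z t, |D5 l z t| ≤ c) (f : E) : BoundedContinuousFunction Ω E :=
  BoundedContinuousFunction.ofNormedAddCommGroup (fun z => D5 l z ⟪φ z, f⟫ • φ z)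
    ((hD.comp (continuous_id.prodMk (continuous_inner_feature φ f))).smul φ.continuous)
    (c * ‖φ‖) fun z => by
      rw [norm_smul]
      exact mul_le_mul (hc _ _) (φ.norm_coe_le_norm z) (norm_nonneg _)
        ((abs_nonneg _).trans (hc z 0))

variable (hdiff : ∀ z, Differentiable ℝ (l z)) (hD : Continuous (Function.uncurry (D5 l)))
  {c : ℝ} (hc : ∀ z t, |D5 l z t| ≤ c)

variable [SecondCountableTopology Ω]

theorem inner_integral_gradBCF [CompleteSpace E] (μ : Measure Ω) [IsFiniteMeasure μ] (f g : E) :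
    ⟪∫ z, gradBCF φ hD hc f z ∂μ, g⟫ = ∫ z, D5 l z ⟪φ z, f⟫ * ⟪φ z, g⟫ ∂μ := by
  have hG : Integrable (gradBCF φ hD hc f) μ :=
    Integrable.of_bound (gradBCF φ hD hc f).continuous.aestronglyMeasurable _
      (ae_of_all _ (gradBCF φ hD hc f).norm_coe_le_norm)
  rw [real_inner_comm, ← integral_inner hG]
  refine integral_congr_ae (ae_of_all _ fun z => ?_)
  change ⟪g, D5 l z ⟪φ z, f⟫ • φ z⟫ = _
  rw [inner_smul_right, real_inner_comm (φ z) g]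

include hdiff in
/-- The first-order optimality condition for the regularized risk. -/
theorem integral_gradBCF_add_eq_zero [CompleteSpace E] (hl : Measurable (Function.uncurry l))
    (hLip : ∀ z, LipschitzWith K (l z)) (h0 : ∀ z, l z 0 = 0)
    (μ : Measure Ω) [IsProbabilityMeasure μ] {lam : ℝ} {f : E}
    (hf : ∀ g, featureRisk l φ μ f + lam * ‖f‖ ^ 2 ≤ featureRisk l φ μ g + lam * ‖g‖ ^ 2) :
    (∫ z, gradBCF φ hD hc f z ∂μ) + (2 * lam) • f = 0 := by
  refine ext_inner_right ℝ fun g => ?_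
  rw [inner_zero_left, inner_add_left, inner_integral_gradBCF, real_inner_smul_left]
  have hline : ∀ z, HasDerivAt (fun t : ℝ => ⟪φ z, f + t • g⟫) ⟪φ z, g⟫ 0 := fun z => by
    simp_rw [inner_add_right, inner_smul_right]
    simpa using ((hasDerivAt_id (0 : ℝ)).mul_const ⟪φ z, g⟫).const_add ⟪φ z, f⟫
  -- Differentiation under the integral along a line, dominated by the uniform Lipschitz constant of
  -- the integrand in `t`.
  have hR : HasDerivAt (fun t : ℝ => featureRisk l φ μ (f + t • g))
      (∫ z, D5 l z ⟪φ z, f⟫ * ⟪φ z, g⟫ ∂μ) 0 := by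
    refine (hasDerivAt_integral_of_dominated_loc_of_lip (s := Set.univ)
      (F := fun t z => l z ⟪φ z, f + t • g⟫) (bound := fun _ => K * ‖φ‖ * ‖g‖)
      Filter.univ_mem (.of_forall fun t => aestronglyMeasurable_featureLoss φ hl μ _)
      (integrable_featureLoss φ hl hLip h0 μ _) ?_ (ae_of_all _ fun z => ?_)
      (integrable_const _) (ae_of_all _ fun z => ?_)).2
    · exact ((hD.comp (continuous_id.prodMk (continuous_inner_feature φ f))).mul
        (continuous_inner_feature φ g)).aestronglyMeasurable
    · refine LipschitzOnWith.of_dist_le_mul fun s _ t _ => ?_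
      have h := abs_featureLoss_sub_le φ hLip z (f + s • g) (f + t • g)
      rw [add_sub_add_left_eq_sub, ← sub_smul, norm_smul] at h
      rw [Real.dist_eq, Real.dist_eq, Real.coe_nnabs,
        abs_of_nonneg (by positivity : 0 ≤ K * ‖φ‖ * ‖g‖)]
      calc _ ≤ _ := h
        _ = _ := by rw [Real.norm_eq_abs]; ring
    · have h1 : HasDerivAt (l z) (D5 l z ⟪φ z, f⟫) ⟪φ z, f + (0 : ℝ) • g⟫ := by
        rw [zero_smul, add_zero]
        exact (hdiff z _).hasDerivAt
      exact h1.comp (0 : ℝ) (hline z)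
  have hN : HasDerivAt (fun t : ℝ => lam * ‖f + t • g‖ ^ 2) (2 * lam * ⟪f, g⟫) 0 := by
    have h1 : HasDerivAt (fun t : ℝ => f + t • g) g 0 := by
      simpa using ((hasDerivAt_id (0 : ℝ)).smul_const g).const_add f
    have h2 := h1.norm_sq.const_mul lam
    simp only [zero_smul, add_zero] at h2
    rwa [← mul_assoc, mul_comm lam 2] at h2
  refine IsLocalMin.hasDerivAt_eq_zero (.of_forall fun t => ?_) (hR.add hN)
  simpa using hf (f + t • g)

include hdiff in
/-- The subgradient inequality for the risk. -/
theorem featureRisk_add_inner_le [CompleteSpace E] (hl : Measurable (Function.uncurry l))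
    (hLip : ∀ z, LipschitzWith K (l z)) (h0 : ∀ z, l z 0 = 0)
    (hconv : ∀ z, ConvexOn ℝ Set.univ (l z))
    (μ : Measure Ω) [IsProbabilityMeasure μ] (f g : E) :
    featureRisk l φ μ f + ⟪∫ z, gradBCF φ hD hc f z ∂μ, g - f⟫ ≤ featureRisk l φ μ g := by
  have hi := integrable_featureLoss φ hl hLip h0 μ
  have hi2 : Integrable (fun z => D5 l z ⟪φ z, f⟫ * ⟪φ z, g - f⟫) μ := by
    refine Integrable.of_bound ((hD.comp (continuous_id.prodMk
      (continuous_inner_feature φ f))).mul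
        (continuous_inner_feature φ (g - f))).aestronglyMeasurable (c * (‖φ‖ * ‖g - f‖))
        (ae_of_all _ fun z => ?_)
    rw [norm_mul]
    exact mul_le_mul (hc _ _) (abs_inner_feature_le φ z _) (norm_nonneg _)
      ((abs_nonneg _).trans (hc z 0))
  rw [inner_integral_gradBCF, featureRisk, featureRisk, ← integral_add (hi f) hi2]
  refine integral_mono ((hi f).add hi2) (hi g) fun z => ?_
  have hd := (hdiff z ⟪φ z, f⟫).hasDerivAt
  simp only [inner_sub_right, D5]
  -- The tangent line lies below a convex function; the slope comparison depends on the order of the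
  -- two points.
  rcases lt_trichotomy ⟪φ z, f⟫ ⟪φ z, g⟫ with h | h | h
  · have h1 := (hconv z).le_slope_of_hasDerivAt (Set.mem_univ _) (Set.mem_univ _) h hd
    rw [slope_def_field, le_div_iff₀ (sub_pos.2 h)] at h1
    linarith
  · simp [h]
  · have h1 := (hconv z).slope_le_of_hasDerivAt (Set.mem_univ _) (Set.mem_univ _) h hd
    rw [slope_def_field, div_le_iff₀ (sub_pos.2 h)] at h1
    linarith

include hdiff in
/-- Stability of minimizers: their distance is controlled by the gradients of the two risks at
one of them. -/
theorem norm_minimizer_sub_le [CompleteSpace E] (hl : Measurable (Function.uncurry l))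
    (hLip : ∀ z, LipschitzWith K (l z)) (h0 : ∀ z, l z 0 = 0)
    (hconv : ∀ z, ConvexOn ℝ Set.univ (l z))
    (μ ν : Measure Ω) [IsProbabilityMeasure μ] [IsProbabilityMeasure ν]
    {lam : ℝ} (hlam : 0 < lam) {f g : E}
    (hf : ∀ u, featureRisk l φ μ f + lam * ‖f‖ ^ 2 ≤ featureRisk l φ μ u + lam * ‖u‖ ^ 2)
    (hg : ∀ u, featureRisk l φ ν g + lam * ‖g‖ ^ 2 ≤ featureRisk l φ ν u + lam * ‖u‖ ^ 2) :
    ‖g - f‖ ≤ lam⁻¹ * ‖(∫ z, gradBCF φ hD hc f z ∂ν) - ∫ z, gradBCF φ hD hc f z ∂μ‖ := by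
  have h1 := integral_gradBCF_add_eq_zero φ hdiff hD hc hl hLip h0 μ hf
  have h2 := featureRisk_add_inner_le φ hdiff hD hc hl hLip h0 hconv ν f g
  have h3 := hg f
  set A := ∫ z, gradBCF φ hD hc f z ∂ν
  set B := ∫ z, gradBCF φ hD hc f z ∂μ
  have h4 : ‖g‖ ^ 2 - ‖f‖ ^ 2 = 2 * ⟪f, g - f⟫ + ‖g - f‖ ^ 2 := by
    have := norm_add_sq_real f (g - f)
    rw [add_sub_cancel] at this
    linarith
  have h5 : ⟪B, g - f⟫ + 2 * lam * ⟪f, g - f⟫ = 0 := by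
    rw [← real_inner_smul_left, ← inner_add_left, h1, inner_zero_left]
  have h6 := real_inner_le_norm (-(A - B)) (g - f)
  rw [inner_neg_left, inner_sub_left, norm_neg] at h6
  -- `h2` and `h3` give `⟪A, g - f⟫ ≤ lam * (‖f‖ ^ 2 - ‖g‖ ^ 2)`, which by `h4` and `h5` equals `⟪B,
  -- g - f⟫ - lam * ‖g - f‖ ^ 2`; Cauchy–Schwarz (`h6`) finishes.
  have h7 : ‖g - f‖ * (lam * ‖g - f‖) ≤ ‖g - f‖ * ‖A - B‖ := by nlinarith
  rcases (norm_nonneg (g - f)).eq_or_lt with h | h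
  · rw [← h]
    positivity
  · rw [inv_mul_eq_div, le_div_iff₀ hlam, mul_comm]
    exact le_of_mul_le_mul_left h7 h

include hdiff hD hc in
/-- The minimizer of the regularized risk depends continuously on the probability measure. -/
theorem continuous_featureRisk_minimizer [TopologicalSpace.PseudoMetrizableSpace Ω]
    [CompleteSpace E] (hl : Measurable (Function.uncurry l))
    (hLip : ∀ z, LipschitzWith K (l z)) (h0 : ∀ z, l z 0 = 0)
    (hconv : ∀ z, ConvexOn ℝ Set.univ (l z)) {lam : ℝ} (hlam : 0 < lam)
    {S : ProbabilityMeasure Ω → E}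
    (hS : ∀ (μ : ProbabilityMeasure Ω) u, featureRisk l φ μ (S μ) + lam * ‖S μ‖ ^ 2
      ≤ featureRisk l φ μ u + lam * ‖u‖ ^ 2) :
    Continuous S := by
  rw [continuous_iff_continuousAt]
  intro μ
  rw [ContinuousAt, tendsto_iff_norm_sub_tendsto_zero]
  -- The gradient is taken at the limit minimizer `S μ`, so the integrand stays fixed while `ν`
  -- varies.
  have h := tendsto_iff_norm_sub_tendsto_zero.1
    ((continuous_integral_boundedContinuous (gradBCF φ hD hc (S μ))).tendsto μ)
  refine squeeze_zero (fun _ => norm_nonneg _) (fun ν => norm_minimizer_sub_le φ hdiff hD hc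
    hl hLip h0 hconv (μ : Measure Ω) (ν : Measure Ω) hlam (hS μ) (hS ν)) ?_
  simpa using h.const_mul lam⁻¹

end FeatureRisk

/-! ### The canonical feature map of the kernel. -/

section Kernel

variable {V H : Type*} [NormedAddCommGroup H] [InnerProductSpace ℝ H] [CompleteSpace H]
  [RKHS ℝ H V ℝ]

variable {k : V → V → ℝ} (hkH : ∀ v w, RKHS.kernel H v w 1 = k v w)
include hkH

theorem inner_kerFun_one (v w : V) :
    ⟪RKHS.kerFun H v (1 : ℝ), RKHS.kerFun H w (1 : ℝ)⟫ = k v w := by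
  rw [RKHS.kerFun_inner, RKHS.kerFun_apply, hkH]
  simp

theorem norm_kerFun_one (v : V) : ‖RKHS.kerFun H v (1 : ℝ)‖ = √(k v v) := by
  rw [← inner_kerFun_one hkH, real_inner_self_eq_norm_sq, Real.sqrt_sq (norm_nonneg _)]

theorem continuous_kerFun_one [TopologicalSpace V] (hk : Continuous (Function.uncurry k)) :
    Continuous fun v => RKHS.kerFun H v (1 : ℝ) := by
  rw [continuous_iff_continuousAt]
  intro w
  rw [ContinuousAt, tendsto_iff_norm_sub_tendsto_zero]
  -- The squared distance is `k v v - 2 * k v w + k w w`.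
  have h : Continuous fun v => √(‖RKHS.kerFun H v (1 : ℝ) - RKHS.kerFun H w (1 : ℝ)‖ ^ 2) := by
    simp_rw [norm_sub_sq_real, ← real_inner_self_eq_norm_sq, inner_kerFun_one hkH]
    have h1 : Continuous fun v => k v v := hk.comp (continuous_id.prodMk continuous_id)
    have h2 : Continuous fun v => k v w := hk.comp (continuous_id.prodMk continuous_const)
    exact ((h1.sub (h2.const_mul 2)).add continuous_const).sqrt
  simpa [Real.sqrt_sq (norm_nonneg _)] using h.tendsto w

/-- The canonical feature map of a reproducing kernel Hilbert space with bounded continuous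
kernel. -/
theorem exists_featureBCF [TopologicalSpace V] (hk : Continuous (Function.uncurry k))
    (hb : BddAbove (Set.range fun v => √(k v v))) :
    ∃ Φ : BoundedContinuousFunction V H, ∀ v f, ⟪Φ v, f⟫ = f v := by
  obtain ⟨C, hC⟩ := hb
  refine ⟨BoundedContinuousFunction.ofNormedAddCommGroup _ (continuous_kerFun_one hkH hk) C
    fun v => (norm_kerFun_one hkH v).trans_le (hC ⟨v, rfl⟩), fun v f => ?_⟩
  change ⟪RKHS.kerFun H v (1 : ℝ), f⟫ = f v
  rw [RKHS.kerFun_inner]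
  simp

end Kernel

/-- Evaluation against a bounded continuous feature map, as a continuous linear map into the
bounded continuous functions. -/
noncomputable def featureEval {V H : Type*} [TopologicalSpace V] [NormedAddCommGroup H]
    [InnerProductSpace ℝ H] (Φ : BoundedContinuousFunction V H) :
    H →L[ℝ] BoundedContinuousFunction V ℝ :=
  LinearMap.mkContinuous
    { toFun := fun f => BoundedContinuousFunction.ofNormedAddCommGroup (fun v => ⟪Φ v, f⟫)
        (Φ.continuous.inner continuous_const) (‖Φ‖ * ‖f‖) fun v => abs_inner_feature_le Φ v f
      map_add' := fun f g => by ext v; exact inner_add_right _ _ _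
      map_smul' := fun a f => by ext v; exact inner_smul_right _ _ _ }
    ‖Φ‖ fun f => BoundedContinuousFunction.norm_ofNormedAddCommGroup_le
      (Φ.continuous.inner continuous_const) (by positivity) fun v => abs_inner_feature_le Φ v f

theorem D5_shifted {Z : Type*} (L : Z → ℝ → ℝ) : D5 (shifted L) = D5 L := by
  funext z t
  exact deriv_sub_const (L z 0)

end PairwiseLearning

/-! ### Transfer to pairwise learning with product measures. -/

theorem mainTheorem6 {X : Type*} [MetricSpace X] [CompleteSpace X]
    [TopologicalSpace.SeparableSpace X] [MeasurableSpace X] [BorelSpace X]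
    (Y : Set ℝ) (hY : IsClosed Y)
    {H : Type*} [NormedAddCommGroup H] [InnerProductSpace ℝ H] [CompleteSpace H]
    [TopologicalSpace.SeparableSpace H] [RKHS ℝ H (X × X) ℝ]
    (k : X × X → X × X → ℝ)
    (hkH : ∀ v w, RKHS.kernel H v w 1 = k v w)
    (hkcont : Continuous (Function.uncurry k))
    (hkbdd : BddAbove (Set.range fun v => Real.sqrt (k v v)))
    (L : (X × Y) × (X × Y) → ℝ → ℝ)
    (hL : PairwiseLearning.IsPairwiseLoss L)
    (hLip : ∃ K : NNReal, ∀ z, LipschitzWith K (L z))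
    (hconv : ∀ z, ConvexOn ℝ Set.univ (L z))
    (hdiff : ∀ z, Differentiable ℝ (L z))
    (hD5cont : Continuous (Function.uncurry (PairwiseLearning.D5 L)))
    (hD5bdd : ∃ c, ∀ z t, |PairwiseLearning.D5 L z t| ≤ c)
    (hdiff2 : ∀ z, Differentiable ℝ (PairwiseLearning.D5 L z))
    (hD5D5cont :
      Continuous (Function.uncurry (PairwiseLearning.D5 (PairwiseLearning.D5 L))))
    (hD5D5bdd : ∃ c, ∀ z t, |PairwiseLearning.D5 (PairwiseLearning.D5 L) z t| ≤ c)
    (lam : ℝ) (hlam : 0 < lam) :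
    -- the risks are finite and the minimizers exist and are unique
    (∀ (P : MeasureTheory.ProbabilityMeasure (X × Y)) (f : H),
      MeasureTheory.Integrable
        (PairwiseLearning.lossAt (PairwiseLearning.shifted L) f)
        ((P : MeasureTheory.Measure (X × Y)).prod (P : MeasureTheory.Measure (X × Y)))) ∧
    (∀ P : MeasureTheory.ProbabilityMeasure (X × Y),
      ∃! f : H, PairwiseLearning.IsRegRiskMinimizer (PairwiseLearning.shifted L) lam P f) ∧
    -- continuity into `H`
    Continuous (fun P : MeasureTheory.ProbabilityMeasure (X × Y) =>
      PairwiseLearning.rplOperator H L lam P) ∧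
    -- continuity into the bounded continuous functions on `X × X`
    ∃ T : MeasureTheory.ProbabilityMeasure (X × Y) → BoundedContinuousFunction (X × X) ℝ,
      (∀ P v, T P v = PairwiseLearning.rplOperator H L lam P v) ∧ Continuous T := by
  -- Second countability makes open sets of the product spaces measurable for the product σ-algebra.
  have := UniformSpace.secondCountable_of_separable X
  obtain ⟨K, hK⟩ := hLip
  obtain ⟨c, hc⟩ := hD5bdd
  obtain ⟨Φ, hΦ⟩ := PairwiseLearning.exists_featureBCF hkH hkcont hkbdd
  let l := PairwiseLearning.shifted L
  let φ : BoundedContinuousFunction ((X × Y) × (X × Y)) H :=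
    Φ.compContinuous ⟨fun z => (z.1.1, z.2.1), by fun_prop⟩
  have hφ : ∀ z f, inner ℝ (φ z) f = f (z.1.1, z.2.1) := fun z f => hΦ _ f
  have hl : Measurable (Function.uncurry l) :=
    hL.measurable.sub (hL.measurable.comp (measurable_fst.prodMk measurable_const))
  have hlLip : ∀ z, LipschitzWith K (l z) := fun z => LipschitzWith.of_dist_le_mul fun s t => by
    simpa [l, PairwiseLearning.shifted] using (hK z).dist_le_mul s t
  have hl0 : ∀ z, l z 0 = 0 := fun z => sub_self _
  have hlconv : ∀ z, ConvexOn ℝ Set.univ (l z) := fun z => by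
    have h := (hconv z).add_const (-L z 0)
    exact h.congr fun t _ => (sub_eq_add_neg _ _).symm
  have hldiff : ∀ z, Differentiable ℝ (l z) := fun z => (hdiff z).sub_const _
  have hlD : Continuous (Function.uncurry (PairwiseLearning.D5 l)) := by
    rw [PairwiseLearning.D5_shifted]
    exact hD5cont
  have hlc : ∀ z t, |PairwiseLearning.D5 l z t| ≤ c := by
    rw [PairwiseLearning.D5_shifted]
    exact hc
  have hloss : ∀ f : H, PairwiseLearning.lossAt l f = fun z => l z (inner ℝ (φ z) f) :=
    fun f => funext fun z => by rw [hφ]; rfl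
  have hmin : ∀ (P : MeasureTheory.ProbabilityMeasure (X × Y)) (f : H),
      PairwiseLearning.IsRegRiskMinimizer l lam P f ↔
        ∀ g, PairwiseLearning.featureRisk l φ (P.prod P) f + lam * ‖f‖ ^ 2
          ≤ PairwiseLearning.featureRisk l φ (P.prod P) g + lam * ‖g‖ ^ 2 := fun P f => by
    simp only [PairwiseLearning.IsRegRiskMinimizer, PairwiseLearning.regRisk,
      PairwiseLearning.risk, hloss, PairwiseLearning.featureRisk,
      MeasureTheory.ProbabilityMeasure.toMeasure_prod]
  have hex := fun Q : MeasureTheory.ProbabilityMeasure ((X × Y) × (X × Y)) =>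
    PairwiseLearning.existsUnique_featureRisk_minimizer φ hl hlLip hl0 hlconv
      (Q : MeasureTheory.Measure _) hlam
  have hexP : ∀ P : MeasureTheory.ProbabilityMeasure (X × Y),
      ∃! f : H, PairwiseLearning.IsRegRiskMinimizer l lam P f := fun P => by
    simp only [hmin]
    exact hex (P.prod P)
  choose S hS hSu using hex
  -- The `Classical.epsilon` choice is a genuine minimizer because one exists; uniqueness identifies
  -- it with `S` at `P ⊗ P`.
  have hSP : ∀ P : MeasureTheory.ProbabilityMeasure (X × Y),
      PairwiseLearning.rplOperator H L lam P = S (P.prod P) := fun P =>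
    hSu _ _ ((hmin P _).1 (Classical.epsilon_spec (hexP P).exists))
  have hcont : Continuous fun P : MeasureTheory.ProbabilityMeasure (X × Y) =>
      PairwiseLearning.rplOperator H L lam P := by
    simp_rw [hSP]
    exact (PairwiseLearning.continuous_featureRisk_minimizer φ hldiff hlD hlc hl hlLip hl0 hlconv
      hlam hS).comp
      (MeasureTheory.ProbabilityMeasure.continuous_prod.comp (continuous_id.prodMk continuous_id))
  refine ⟨fun P f => ?_, hexP, hcont,
    fun P => PairwiseLearning.featureEval Φ (PairwiseLearning.rplOperator H L lam P),
    fun P v => hΦ v _, (PairwiseLearning.featureEval Φ).continuous.comp hcont⟩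
  rw [show PairwiseLearning.shifted L = l from rfl, hloss]
  exact PairwiseLearning.integrable_featureLoss φ hl hlLip hl0 _ f
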